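/- Let $p$ be a prime and let $(R,\mathfrak m,\Bbbk)$ be an $F$-finite Noetherian local domain of characteristic $p$ and dimension $d$, with fraction field $\mathbb F$. Let $\mathbf a\in\mathbb R^d$ have $\mathbb Q$-linearly independent components, order $\mathbb Z^d$ by $\mathbf u\le\mathbf w\iff\langle\mathbf u,\mathbf a\rangle\le\langle\mathbf w,\mathbf a\rangle$, and let $\nu:\mathbb F^\times\to\mathbb Z^d$ be a valuation that is OK relative to $R$; that is, writing $\nu(N)=\{\nu(x):0\ne x\in N\}$ for $N\subset\mathbb F$: 1. $\nu(R)$ generates $\mathbb Z^d$ as a group, and $\nu(\mathbb F)=\mathbb Z^d$; 2. $R$ is dominated by $\nu$ ($\nu\ge 0$ on $R\setminus\{0\}$ and $\nu>0$ on $\mathfrak m\setminus\{0\}$); 3. the closed convex cone $C=\mathrm{Cone}(\nu(R))\subset\mathbb R^d$ generated by $\nu(R)$ is pointed at direction $\mathbf a$, i.e. for some $0<c<\|\mathbf a\|$ one has $\langle\mathbf x,\mathbf a\rangle\ge c\|\mathbf x\|$ for all $\mathbf x\in C$; 4. the residue field $\Bbbk_\nu$ of $\nu$ satisfies $[\Bbbk_\nu:\Bbbk]<\infty$;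 5. there is $\mathbf v\in\mathbb Z^d$ such that every $x\in R$ with $x=0$ or $\nu(x)\ge n\mathbf v$ lies in $\mathfrak m^n$, for all $n\in\mathbb N$. (A domain $R$ that admits such a $\nu$ is called an OK domain.) Let $I_\bullet=\{I_q\}_{q=p^e,\,e\ge 0}$ be a family of ideals of $R$ that is - an $F$-graded system: $I_{q_1}^{[q_2]}I_{q_2}\subset I_{q_1q_2}$ for all powers $q_1,q_2$ of $p$, where $I^{[q]}$ is the ideal generated by the $q$-th powers of the elements of $I$; - bounded below linearly (BBL): there is $c\in\mathbb N$ with $\mathfrak m^{cq}\subset I_q$ for all $q=p^e$ (so each $I_q$ is $\mathfrak m$-primary or equal to $R$). Put $[\mathbf x]_q=\frac1q\lfloor q\mathbf x\rfloor$ (coordinatewise floor) and $$\Delta(I_\bullet)=\bigcup_{f\ge 0}\ \bigcap_{e\ge f}\left\{\mathbf x\in C:\ [\mathbf x]_{p^e}\in \tfrac1{p^e}\,\nu(I_{p^e})\right\}.$$ Then $C\setminus\Delta(I_\bullet)$ is a Borel set of finite Lebesgue measure, the limit defining the volume of $I_\bullet$ exists, and $$\mathrm{vol}(I_\bullet):=\lim_{q=p^e\to\infty}\frac{\ell_R(R/I_q)}{q^d}=[\Bbbk_\nu:\Bbbk]\cdot\mathrm{vol}\bigl(C\setminus\Delta(I_\bullet)\bigr).$$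 In particular $\mathrm{vol}(I_\bullet)=\mathrm{vol}(C\setminus\Delta(I_\bullet))$ whenever $\Bbbk_\nu=\Bbbk$. -/

import Mathlib

open Filter Topology MeasureTheory IsLocalRing

noncomputable section

namespace OKDomain

/-- The group `ℤ^d`, totally ordered by `u ≤ w ↔ ⟨u, a⟩ ≤ ⟨w, a⟩`, where the components of
`a ∈ ℝ^d` are linearly independent over `ℚ`. -/
def Lattice {d : ℕ} (a : EuclideanSpace ℝ (Fin d))
    (_ha : LinearIndependent ℚ (fun i => a i)) : Type :=
  Fin d → ℤ

namespace Lattice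

variable {d : ℕ} {a : EuclideanSpace ℝ (Fin d)} {ha : LinearIndependent ℚ (fun i => a i)}

instance : AddCommGroup (Lattice a ha) :=
  inferInstanceAs (AddCommGroup (Fin d → ℤ))

/-- The `i`-th coordinate of a lattice vector. -/
def coord (u : Lattice a ha) (i : Fin d) : ℤ := u i

/-- The lattice vector regarded as a point of `ℝ^d`. -/
def toReal (u : Lattice a ha) : EuclideanSpace ℝ (Fin d) :=
  WithLp.toLp 2 (fun i => (u.coord i : ℝ))

theorem inner_toReal (u : Lattice a ha) :
    inner ℝ u.toReal a = ∑ i, (u.coord i : ℝ) * a i := by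
  simp [PiLp.inner_apply, toReal, mul_comm]

theorem inner_injective :
    Function.Injective (fun u : Lattice a ha => (inner ℝ u.toReal a : ℝ)) := by
  intro u w h
  simp only [inner_toReal] at h
  have h2 : ∑ i, (((u.coord i - w.coord i : ℤ) : ℚ)) • a i = 0 := by
    have : ∑ i, ((u.coord i : ℝ) - w.coord i) * a i = 0 := by
      simp only [sub_mul, Finset.sum_sub_distrib]
      linarith
    rw [← this]
    refine Finset.sum_congr rfl fun i _ => ?_
    rw [Rat.smul_def]
    push_cast
    ring
  have h3 := Fintype.linearIndependent_iff.mp ha _ h2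
  funext i
  have h4 := h3 i
  rw [Int.cast_eq_zero] at h4
  exact sub_eq_zero.mp h4

instance : LinearOrder (Lattice a ha) :=
  LinearOrder.lift' (fun u => (inner ℝ u.toReal a : ℝ)) inner_injective

theorem le_iff (u w : Lattice a ha) :
    u ≤ w ↔ (inner ℝ u.toReal a : ℝ) ≤ inner ℝ w.toReal a := Iff.rfl

theorem toReal_add (u w : Lattice a ha) : (u + w).toReal = u.toReal + w.toReal := by
  ext i
  exact Int.cast_add (u.coord i) (w.coord i)

instance : IsOrderedAddMonoid (Lattice a ha) where
  add_le_add_left u w h c := by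
    rw [le_iff] at h ⊢
    simp only [toReal_add, inner_add_left]
    linarith

end Lattice

/-- `Cone(U)`: the smallest closed convex cone containing `U`, that is, the closure of the set of
all linear combinations of elements of `U` with nonnegative coefficients. -/
def closedCone {d : ℕ} (U : Set (EuclideanSpace ℝ (Fin d))) : Set (EuclideanSpace ℝ (Fin d)) :=
  closure (PointedCone.hull ℝ U : Set (EuclideanSpace ℝ (Fin d)))

/-- `C` lies in a circular cone `{x | ⟨x, a⟩ ≥ c ‖x‖}` with `0 < c < ‖a‖`. -/
def IsPointedAt {d : ℕ} (C : Set (EuclideanSpace ℝ (Fin d))) (a : EuclideanSpace ℝ (Fin d)) :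
    Prop :=
  ∃ c : ℝ, 0 < c ∧ c < ‖a‖ ∧ ∀ x ∈ C, c * ‖x‖ ≤ inner ℝ x a

section Valuations

variable (R : Type*) [CommRing R] {K : Type*} [Field K] [Algebra R K]
variable {d : ℕ} {a : EuclideanSpace ℝ (Fin d)} {ha : LinearIndependent ℚ (fun i => a i)}

/-- The value set `ν(N) = {ν(x) | 0 ≠ x ∈ N}` of a subset `N` of the field. (Finite values are
taken exactly at nonzero elements.) -/
def valueSet (v : AddValuation K (WithTop (Lattice a ha))) (N : Set K) : Set (Lattice a ha) :=
  {u | ∃ x ∈ N, v x = (u : WithTop (Lattice a ha))}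

variable {R} in
/-- The value set `ν(I)` of an ideal `I` of `R`. -/
def idealValues (v : AddValuation K (WithTop (Lattice a ha))) (I : Ideal R) :
    Set (Lattice a ha) :=
  valueSet v (algebraMap R K '' (I : Set R))

/-- The value semigroup `ν(R)`. -/
def ringValues (v : AddValuation K (WithTop (Lattice a ha))) : Set (Lattice a ha) :=
  valueSet v (Set.range (algebraMap R K))

/-- The cone `C = Cone(ν(R))`. -/
def valueCone (v : AddValuation K (WithTop (Lattice a ha))) :
    Set (EuclideanSpace ℝ (Fin d)) :=
  closedCone (Lattice.toReal '' ringValues R v)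

/-- The valuation ring `V_ν = {x | ν(x) ≥ 0}`. -/
abbrev valuationRing (v : AddValuation K (WithTop (Lattice a ha))) : ValuationSubring K :=
  (AddValuation.toValuation v).valuationSubring

theorem mem_valuationRing (v : AddValuation K (WithTop (Lattice a ha))) (x : K) :
    x ∈ valuationRing v ↔ 0 ≤ v x := Iff.rfl

/-- The local ring `(R, 𝔪)` is dominated by `ν`: `R ⊆ V_ν` and `𝔪 ⊆ 𝔪_ν`. -/
structure Dominates [IsLocalRing R] (v : AddValuation K (WithTop (Lattice a ha))) : Prop where
  nonneg : ∀ r : R, 0 ≤ v (algebraMap R K r)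
  pos : ∀ r ∈ maximalIdeal R, 0 < v (algebraMap R K r)

variable {R} in
/-- The inclusion `R → V_ν` of a dominated local ring. -/
def Dominates.toValuationRing [IsLocalRing R] {v : AddValuation K (WithTop (Lattice a ha))}
    (h : Dominates R v) : R →+* valuationRing v :=
  (algebraMap R K).codRestrict (valuationRing v).toSubring h.nonneg

variable {R} in
theorem Dominates.isLocalHom [IsLocalRing R] {v : AddValuation K (WithTop (Lattice a ha))}
    (h : Dominates R v) : IsLocalHom h.toValuationRing := by
  constructor
  intro r hr
  by_contra hnu
  have hpos := h.pos r ((mem_maximalIdeal r).mpr hnu)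
  obtain ⟨y, hy⟩ := hr.exists_right_inv
  have hy' : algebraMap R K r * (y : K) = 1 := congrArg Subtype.val hy
  have hv := congrArg v hy'
  rw [v.map_mul, v.map_one] at hv
  have hy0 : 0 ≤ v (y : K) := (mem_valuationRing v y).mp y.2
  exact absurd hv (ne_of_gt (add_pos_of_pos_of_nonneg hpos hy0))

variable {R} in
/-- The extension of residue fields `𝕜 → 𝕜_ν`. -/
def Dominates.residueMap [IsLocalRing R] {v : AddValuation K (WithTop (Lattice a ha))}
    (h : Dominates R v) : ResidueField R →+* ResidueField (valuationRing v) :=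
  letI := h.isLocalHom
  ResidueField.map h.toValuationRing

variable {R} in
/-- The degree `[𝕜_ν : 𝕜]` of the extension of residue fields. -/
def Dominates.residueDegree [IsLocalRing R] {v : AddValuation K (WithTop (Lattice a ha))}
    (h : Dominates R v) : ℕ :=
  letI := h.residueMap.toAlgebra
  Module.finrank (ResidueField R) (ResidueField (valuationRing v))

/-- A valuation on the fraction field of a local domain `R` of dimension `d`, with values in
`ℤ^d` ordered by `a`, is *OK relative to `R`*. -/
structure IsOKValuation [IsLocalRing R] (v : AddValuation K (WithTop (Lattice a ha))) :
    Prop where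
  dim_eq : ringKrullDim R = d
  closure_ringValues : AddSubgroup.closure (ringValues R v) = ⊤
  valueGroup_eq : valueSet v Set.univ = Set.univ
  dominates : Dominates R v
  pointed : IsPointedAt (valueCone R v) a
  finite_residue : dominates.residueMap.Finite
  linear_bound : ∃ w : Lattice a ha, ∀ (n : ℕ) (r : R),
    ((n • w : Lattice a ha) : WithTop (Lattice a ha)) ≤ v (algebraMap R K r) →
      r ∈ maximalIdeal R ^ n

end Valuations

section Families

variable {R : Type*} [CommRing R]

/-- The Frobenius power `I^{[n]}`, generated by the `n`-th powers of the elements of `I`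
(used for `n` a power of the characteristic). -/
def frobeniusPower (I : Ideal R) (n : ℕ) : Ideal R :=
  Ideal.span ((fun x => x ^ n) '' (I : Set R))

/-- `R` is `F`-finite: it is a finite module over itself through the Frobenius endomorphism. -/
def IsFFinite (p : ℕ) (R : Type*) [CommRing R] [ExpChar R p] : Prop :=
  (frobenius R p).Finite

/- A family of ideals indexed by the powers of `p` is a function `I : ℕ → Ideal R`, where `I e` is
the member of the family with index `q = p ^ e`. -/

/-- An `F`-graded system: `I_{q₁}^{[q₂]} I_{q₂} ⊆ I_{q₁ q₂}` for all powers `q₁, q₂` of `p`. -/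
def IsFGraded (p : ℕ) (I : ℕ → Ideal R) : Prop :=
  ∀ e₁ e₂ : ℕ, frobeniusPower (I e₁) (p ^ e₂) * I e₂ ≤ I (e₁ + e₂)

/-- Bounded below linearly: `𝔪^{cq} ⊆ I_q` for a constant `c` and all powers `q` of `p`. -/
def IsBBL [IsLocalRing R] (p : ℕ) (I : ℕ → Ideal R) : Prop :=
  ∃ c : ℕ, ∀ e : ℕ, maximalIdeal R ^ (c * p ^ e) ≤ I e

variable {K : Type*} [Field K] [Algebra R K]
variable {d : ℕ} {a : EuclideanSpace ℝ (Fin d)} {ha : LinearIndependent ℚ (fun i => a i)}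

/-- The lattice vector `⌊n x⌋` (coordinatewise). For `[x]_n = (1/n) ⌊n x⌋` and `L ⊆ ℤ^d` one has
`[x]_n ∈ (1/n) L` if and only if `⌊n x⌋ ∈ L`. -/
def latticeFloor (a : EuclideanSpace ℝ (Fin d)) (ha : LinearIndependent ℚ (fun i => a i))
    (n : ℕ) (x : EuclideanSpace ℝ (Fin d)) : Lattice a ha :=
  fun i => ⌊(n : ℝ) * x i⌋

/-- The limiting value set `Δ(I_•) = ⋃_f ⋂_{e ≥ f} {x ∈ C | [x]_q ∈ (1/q) ν(I_q), q = p^e}`. -/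
def limitSet (p : ℕ) (v : AddValuation K (WithTop (Lattice a ha))) (I : ℕ → Ideal R) :
    Set (EuclideanSpace ℝ (Fin d)) :=
  ⋃ f : ℕ, ⋂ e ≥ f, {x | x ∈ valueCone R v ∧ latticeFloor a ha (p ^ e) x ∈ idealValues v (I e)}

end Families

end OKDomain

end

noncomputable section

namespace OKDomain

/-! ### Lengths of cyclic quotients. -/

section Length

/-! Length is turned into a count of lattice points, and the count into a volume.

Filter an ideal `N` by value. The graded piece at `u` embeds, by leading forms, in `𝕜_ν`; it
vanishes unless `u ∈ ν(N)`, and it is all of `𝕜_ν` at `u + w` whenever `u ∈ ν(N)`, for one `w`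
independent of `N` (`exists_range_leadingForm_eq_top`). Comparing `N` with `R` below a height `H`
such that all elements of value at least `H` lie in `N`, the length of `R/N` equals `[𝕜_ν : 𝕜]`
times the number of points of `ν(R) \ ν(N)`, up to the same multiple of the number of values in a
slab of width `w` below `H` (`length_quotient_bounds`). For `N = I_q` the height grows linearly in
`q`, and the slab has `o(q^d)` points because after rescaling it collapses to a hyperplane
(`tendsto_ncard_slab_div_pow`).

A count divided by `q^d` is the volume of a union of cubes of side `1/q`, so by dominated
convergence it suffices to decide, for almost every `x`, whether `⌊qx⌋` belongs to the set for all
large `q`. For `ν(R)` the answer is the interior of `C`, since the semigroup contains all lattice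
points near a far multiple of an interior point (`exists_mem_of_mem_interior`). For `ν(I_q)` the
`F`-graded condition shows that if `⌊qx⌋ ∈ ν(I_q)` infinitely often, then at `x + z`, with `z`
interior to `C`, this holds for all large `q` (`eventually_latticeFloor_mem_of_frequently`). The
points of undecided behaviour thus meet each line in an interior direction at most once, and form a
null set. -/

theorem length_quotient_mono {R : Type*} [CommRing R] {N M : Ideal R} (h : N ≤ M) :
    Module.length R (R ⧸ M) ≤ Module.length R (R ⧸ N) :=
  Module.length_le_of_surjective (Submodule.factor h) (Submodule.factor_surjective h)

/-- Additivity of length along `0 → M/ker φ → R/N → R/M → 0`, where `N` is `ker φ` viewed in `R`. It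
measures one step of the value filtration. -/
theorem length_quotient_map_ker {R V : Type*} [CommRing R] [AddCommGroup V] [Module R V]
    (M : Ideal R) (φ : M →ₗ[R] V) :
    Module.length R (R ⧸ (LinearMap.ker φ).map M.subtype) =
      Module.length R (R ⧸ M) + Module.length R (LinearMap.range φ) := by
  set N : Ideal R := (LinearMap.ker φ).map M.subtype with hN
  have hNM : N ≤ M := Submodule.map_subtype_le _ _
  let f : (M ⧸ LinearMap.ker φ) →ₗ[R] R ⧸ N :=
    Submodule.mapQ _ N M.subtype (Submodule.le_comap_map _ _)
  have hf : Function.Injective f := by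
    rw [← LinearMap.ker_eq_bot, Submodule.ker_mapQ, hN,
      Submodule.comap_map_eq_of_injective M.injective_subtype, Submodule.mkQ_map_self]
  have hfg : Function.Exact f (Submodule.factor hNM) := by
    rw [LinearMap.exact_iff, Submodule.range_mapQ, Submodule.range_subtype]
    exact Submodule.ker_mapQ _ _ _ _
  rw [Module.length_eq_add_of_exact f (Submodule.factor hNM) hf (Submodule.factor_surjective hNM)
    hfg, φ.quotKerEquivRange.length_eq, add_comm]

end Length

/-! ### Filtration by value and leading forms in the residue field. -/

section LeadingForms

variable {R : Type*} [CommRing R] [IsLocalRing R] {K : Type*} [Field K] [Algebra R K]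
variable {d : ℕ} {a : EuclideanSpace ℝ (Fin d)} {ha : LinearIndependent ℚ (fun i => a i)}
variable {v : AddValuation K (WithTop (Lattice a ha))}

/-- The residue field `𝕜_ν` regarded as an `R`-module. -/
def Dominates.ResidueModule (_h : Dominates R v) : Type _ := ResidueField (valuationRing v)

instance (h : Dominates R v) : AddCommGroup h.ResidueModule :=
  inferInstanceAs (AddCommGroup (ResidueField (valuationRing v)))

instance (h : Dominates R v) : Module R h.ResidueModule :=
  (h.residueMap.comp (residue R)).toAlgebra.toModule

/-- The residue class of an element of `V_ν`, as an element of the `R`-module `𝕜_ν`. -/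
def Dominates.toResidue (h : Dominates R v) (x : valuationRing v) : h.ResidueModule :=
  residue (valuationRing v) x

theorem Dominates.toResidue_surjective (h : Dominates R v) : Function.Surjective h.toResidue :=
  residue_surjective

theorem Dominates.toResidue_add (h : Dominates R v) (x y : valuationRing v) :
    h.toResidue (x + y) = h.toResidue x + h.toResidue y := map_add _ _ _

theorem Dominates.toResidue_smul (h : Dominates R v) (r : R) (x : valuationRing v) :
    h.toResidue (h.toValuationRing r * x) = r • h.toResidue x :=
  map_mul (residue (valuationRing v)) _ _

/-- Since `R` surjects onto `𝕜`, length over `R` is dimension over `𝕜`. -/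
theorem Dominates.length_residueModule (h : Dominates R v) (hfin : h.residueMap.Finite) :
    Module.length R h.ResidueModule = h.residueDegree := by
  let : Algebra (ResidueField R) (ResidueField (valuationRing v)) := h.residueMap.toAlgebra
  let : Module (ResidueField R) h.ResidueModule :=
    inferInstanceAs (Module (ResidueField R) (ResidueField (valuationRing v)))
  have : Module.Finite (ResidueField R) h.ResidueModule := hfin
  have : IsScalarTower R (ResidueField R) h.ResidueModule := by
    refine IsScalarTower.of_algebraMap_smul fun r x => ?_
    rfl
  rw [Module.length_eq_of_surjective (S := R) (R := ResidueField R) (M := h.ResidueModule)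
    residue_surjective, Module.length_eq_finrank]
  rfl

theorem Dominates.finite_residueModule (h : Dominates R v) (hfin : h.residueMap.Finite) :
    Module.Finite R h.ResidueModule :=
  hfin.comp (RingHom.Finite.of_surjective _ residue_surjective)

theorem le_add_coe_iff {u : Lattice a ha} {y : WithTop (Lattice a ha)} :
    (u : WithTop (Lattice a ha)) ≤ y + u ↔ 0 ≤ y := by
  induction y with
  | top => simp
  | coe y => norm_cast; simp

theorem lt_add_coe_iff {u : Lattice a ha} {y : WithTop (Lattice a ha)} :
    (u : WithTop (Lattice a ha)) < y + u ↔ 0 < y := by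
  induction y with
  | top => simp
  | coe y => norm_cast; simp

theorem ne_zero_of_value_eq_coe {t : K} {u : Lattice a ha} (ht : v t = u) : t ≠ 0 := by
  rintro rfl
  simp at ht

theorem value_mul_inv_add {t : K} {u : Lattice a ha} (ht : v t = u) (x : K) :
    v (x * t⁻¹) + u = v x := by
  rw [← ht, ← v.map_mul, inv_mul_cancel_right₀ (ne_zero_of_value_eq_coe ht)]

theorem Dominates.toResidue_eq_zero_iff (h : Dominates R v) (x : valuationRing v) :
    h.toResidue x = 0 ↔ 0 < v (x : K) := by
  have h1 : h.toResidue x = 0 ↔ ¬ IsUnit x :=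
    (residue_eq_zero_iff (R := valuationRing v) x).trans (mem_maximalIdeal x)
  rw [h1, not_iff_comm]
  constructor
  · intro hx
    have hx0 : v (x : K) = 0 := le_antisymm (not_lt.mp hx) ((mem_valuationRing v _).mp x.2)
    have hne : (x : K) ≠ 0 := fun h0 => by simp [h0] at hx0
    have hinv : v (x : K)⁻¹ = 0 := by
      have := congrArg v (mul_inv_cancel₀ hne)
      rwa [v.map_mul, v.map_one, hx0, zero_add] at this
    refine IsUnit.of_mul_eq_one ⟨(x : K)⁻¹, (mem_valuationRing v _).mpr hinv.ge⟩ ?_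
    exact Subtype.ext (mul_inv_cancel₀ hne)
  · intro hx hpos
    obtain ⟨y, hy⟩ := hx.exists_right_inv
    have hy' : (x : K) * (y : K) = 1 := congrArg Subtype.val hy
    have hv := congrArg v hy'
    rw [v.map_mul, v.map_one] at hv
    exact absurd hv (ne_of_gt (add_pos_of_pos_of_nonneg hpos ((mem_valuationRing v _).mp y.2)))

/-- The ideal of elements of value at least `u`. -/
def Dominates.valueIdeal (h : Dominates R v) (u : Lattice a ha) : Ideal R where
  carrier := {r | (u : WithTop (Lattice a ha)) ≤ v (algebraMap R K r)}
  zero_mem' := by simp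
  add_mem' hx hy := by
    simp only [Set.mem_ofPred_eq, map_add] at *
    exact v.map_le_add hx hy
  smul_mem' r x hx := by
    simp only [Set.mem_ofPred_eq, smul_eq_mul, map_mul, v.map_mul] at *
    exact hx.trans (le_add_of_nonneg_left (h.nonneg r))

theorem Dominates.mem_valueIdeal (h : Dominates R v) {u : Lattice a ha} {r : R} :
    r ∈ h.valueIdeal u ↔ (u : WithTop (Lattice a ha)) ≤ v (algebraMap R K r) := Iff.rfl

/-- The class of `x / t` in `𝕜_ν`, for elements `x` of an ideal with `ν(x) ≥ u = ν(t)`. -/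
def Dominates.leadingForm (h : Dominates R v) (N : Ideal R) {u : Lattice a ha} {t : K}
    (ht : v t = u) : (N ⊓ h.valueIdeal u : Ideal R) →ₗ[R] h.ResidueModule where
  toFun x := h.toResidue ⟨algebraMap R K x * t⁻¹, (mem_valuationRing v _).mpr
    (le_add_coe_iff.mp (x.2.2.trans_eq (value_mul_inv_add ht _).symm))⟩
  map_add' x y := by
    rw [← h.toResidue_add]
    congr 1
    exact Subtype.ext (by simp [add_mul])
  map_smul' r x := by
    rw [RingHom.id_apply, ← h.toResidue_smul]
    congr 1
    refine Subtype.ext ?_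
    change algebraMap R K (r * x) * t⁻¹ = algebraMap R K r * (algebraMap R K x * t⁻¹)
    rw [map_mul, mul_assoc]

theorem Dominates.leadingForm_apply (h : Dominates R v) (N : Ideal R) {u : Lattice a ha} {t : K}
    (ht : v t = u) (x : (N ⊓ h.valueIdeal u : Ideal R)) (y : valuationRing v)
    (hy : algebraMap R K x = y * t) : h.leadingForm N ht x = h.toResidue y := by
  change h.toResidue _ = _
  congr 1
  exact Subtype.ext (by simp [hy, ne_zero_of_value_eq_coe ht])

theorem Dominates.mem_map_ker_leadingForm (h : Dominates R v) (N : Ideal R) {u : Lattice a ha}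
    {t : K} (ht : v t = u) (x : R) :
    x ∈ (LinearMap.ker (h.leadingForm N ht)).map (N ⊓ h.valueIdeal u : Ideal R).subtype ↔
      x ∈ N ∧ (u : WithTop (Lattice a ha)) < v (algebraMap R K x) := by
  have key : ∀ x : (N ⊓ h.valueIdeal u : Ideal R), h.leadingForm N ht x = 0 ↔
      (u : WithTop (Lattice a ha)) < v (algebraMap R K x) := by
    intro x
    change h.toResidue _ = 0 ↔ _
    rw [h.toResidue_eq_zero_iff, ← lt_add_coe_iff (u := u), value_mul_inv_add ht]
  simp only [Submodule.mem_map, LinearMap.mem_ker, key, Submodule.subtype_apply]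
  constructor
  · rintro ⟨y, hy, rfl⟩
    exact ⟨y.2.1, hy⟩
  · rintro ⟨hx, hx'⟩
    exact ⟨⟨x, hx, hx'.le⟩, hx', rfl⟩

omit [IsLocalRing R] in
theorem mem_idealValues {N : Ideal R} {u : Lattice a ha} :
    u ∈ idealValues v N ↔ ∃ x ∈ N, v (algebraMap R K x) = u := by
  simp [idealValues, valueSet]

/-- Each value of `N` below `H` costs at most one copy of `𝕜_ν`. The induction removes the largest
value `m`: past `m` no value of `N` remains below `H`, so the kernel of the leading form at `m`
already lies above `H`. -/
theorem Dominates.length_inf_valueIdeal_le (h : Dominates R v) (hfin : h.residueMap.Finite)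
    (hval : valueSet v Set.univ = Set.univ) (N : Ideal R) (A : Finset (Lattice a ha)) :
    ∀ H : Lattice a ha, (∀ u ∈ idealValues v N, u < H → u ∈ A) → (∀ u ∈ A, u < H) →
      Module.length R (R ⧸ (N ⊓ h.valueIdeal H)) ≤
        Module.length R (R ⧸ N) + h.residueDegree * A.card := by
  induction A using Finset.induction_on_max with
  | empty =>
    intro H hA _
    refine (length_quotient_mono (le_inf le_rfl fun x hx => ?_)).trans le_self_add
    rw [h.mem_valueIdeal]
    by_contra hlt
    rw [not_le] at hlt
    obtain ⟨u, hu⟩ := WithTop.ne_top_iff_exists.mp hlt.ne_top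
    rw [← hu, WithTop.coe_lt_coe] at hlt
    exact absurd (hA u (mem_idealValues.mpr ⟨x, hx, hu.symm⟩) hlt) (Finset.notMem_empty _)
  | insert m A hm ih =>
    intro H hA hlt
    have hmA : m ∉ A := fun hmem => lt_irrefl _ (hm m hmem)
    -- Any `t ∈ K` of value `m` can normalise the leading form; only the size of the range matters.
    obtain ⟨t, -, ht⟩ : m ∈ valueSet v Set.univ := hval ▸ Set.mem_univ m
    have h1 := ih m (fun u hu hum => by
      have := hA u hu (hum.trans (hlt m (Finset.mem_insert_self _ _)))
      exact (Finset.mem_insert.mp this).resolve_left hum.ne) hm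
    have h2 := length_quotient_map_ker _ (h.leadingForm N ht)
    have h3 : (LinearMap.ker (h.leadingForm N ht)).map (N ⊓ h.valueIdeal m : Ideal R).subtype ≤
        N ⊓ h.valueIdeal H := by
      intro x hx
      rw [h.mem_map_ker_leadingForm] at hx
      refine ⟨hx.1, ?_⟩
      change x ∈ h.valueIdeal H
      rw [h.mem_valueIdeal]
      by_contra hxH
      rw [not_le] at hxH
      obtain ⟨u, hu⟩ := WithTop.ne_top_iff_exists.mp hxH.ne_top
      have hmu := hx.2
      rw [← hu, WithTop.coe_lt_coe] at hxH hmu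
      rcases Finset.mem_insert.mp (hA u (mem_idealValues.mpr ⟨x, hx.1, hu.symm⟩) hxH) with h4 | h4
      · exact hmu.ne' h4
      · exact lt_asymm hmu (hm u h4)
    have h4 : Module.length R (LinearMap.range (h.leadingForm N ht)) ≤ h.residueDegree := by
      rw [← h.length_residueModule hfin]
      exact Module.length_le_of_injective _ (Submodule.injective_subtype _)
    calc _ ≤ _ := length_quotient_mono h3
      _ ≤ (Module.length R (R ⧸ N) + h.residueDegree * A.card) + h.residueDegree := by
        rw [h2]; exact add_le_add h1 h4
      _ = _ := by
        rw [Finset.card_insert_of_notMem hmA]; push_cast; ring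

/-- Each value with surjective leading form contributes a full copy of `𝕜_ν`. Here `A` need not
exhaust the values of `N`, since the others can only increase the length. -/
theorem Dominates.le_length_inf_valueIdeal (h : Dominates R v) (hfin : h.residueMap.Finite)
    (N : Ideal R) (A : Finset (Lattice a ha))
    (hA : ∀ u ∈ A, ∃ (t : K) (ht : v t = u), LinearMap.range (h.leadingForm N ht) = ⊤) :
    ∀ H : Lattice a ha, (∀ u ∈ A, u < H) →
      Module.length R (R ⧸ N) + h.residueDegree * A.card ≤
        Module.length R (R ⧸ (N ⊓ h.valueIdeal H)) := by
  induction A using Finset.induction_on_max with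
  | empty =>
    intro H _
    simpa using length_quotient_mono (inf_le_left : N ⊓ h.valueIdeal H ≤ N)
  | insert m A hm ih =>
    intro H hlt
    have hmA : m ∉ A := fun hmem => lt_irrefl _ (hm m hmem)
    obtain ⟨t, ht, hr⟩ := hA m (Finset.mem_insert_self _ _)
    have h1 := ih (fun u hu => hA u (Finset.mem_insert_of_mem hu)) m hm
    have h2 := length_quotient_map_ker _ (h.leadingForm N ht)
    rw [hr, Module.length_top, h.length_residueModule hfin] at h2
    have h3 : N ⊓ h.valueIdeal H ≤
        (LinearMap.ker (h.leadingForm N ht)).map (N ⊓ h.valueIdeal m : Ideal R).subtype := by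
      intro x hx
      rw [h.mem_map_ker_leadingForm]
      exact ⟨hx.1, lt_of_lt_of_le
        (WithTop.coe_lt_coe.mpr (hlt m (Finset.mem_insert_self _ _))) hx.2⟩
    calc Module.length R (R ⧸ N) + h.residueDegree * (insert m A).card
        = (Module.length R (R ⧸ N) + h.residueDegree * A.card) + h.residueDegree := by
          rw [Finset.card_insert_of_notMem hmA]; push_cast; ring
      _ ≤ _ := add_le_add h1 le_rfl
      _ = _ := h2.symm
      _ ≤ _ := length_quotient_mono h3

/-- Lift finitely many generators of `𝕜_ν` to `V_ν` and clear their denominators by one `b ∈ R`;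
then `w = ν(b)`. If `n ∈ N` has value `u`, multiplying `n` by the cleared lifts stays in `N`, and
relative to `t = nb` the leading forms are the chosen generators. -/
theorem Dominates.exists_range_leadingForm_eq_top [IsDomain R] [IsFractionRing R K]
    (h : Dominates R v) (hfin : h.residueMap.Finite) :
    ∃ w : Lattice a ha, 0 ≤ w ∧ ∀ (N : Ideal R) (u : Lattice a ha), u ∈ idealValues v N →
      ∃ (t : K) (ht : v t = (u + w : Lattice a ha)),
        LinearMap.range (h.leadingForm N ht) = ⊤ := by
  classical
  obtain ⟨s, hs⟩ := (h.finite_residueModule hfin).fg_top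
  choose g hg using h.toResidue_surjective
  obtain ⟨b, hb⟩ := IsLocalization.exist_integer_multiples_of_finset (nonZeroDivisors R)
    (s.image fun z => (g z : K))
  have hb0 : algebraMap R K b ≠ 0 :=
    IsFractionRing.to_map_ne_zero_of_mem_nonZeroDivisors b.2
  obtain ⟨w, hw⟩ := WithTop.ne_top_iff_exists.mp (v.ne_top_iff.mpr hb0)
  refine ⟨w, WithTop.coe_le_coe.mp (hw ▸ h.nonneg b), fun N u hu => ?_⟩
  obtain ⟨n, hn, hnu⟩ := mem_idealValues.mp hu
  have ht : v (algebraMap R K n * algebraMap R K b) = (u + w : Lattice a ha) := by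
    rw [v.map_mul, hnu, ← hw, WithTop.coe_add]
  refine ⟨_, ht, ?_⟩
  rw [eq_top_iff, ← hs, Submodule.span_le]
  intro z hz
  obtain ⟨r, hr⟩ := hb (g z) (Finset.mem_image_of_mem _ hz)
  have hr' : algebraMap R K (n * r) = (g z : K) * (algebraMap R K n * algebraMap R K b) := by
    rw [map_mul, hr, Algebra.smul_def]
    ring
  have hmem : n * r ∈ N ⊓ h.valueIdeal (u + w) := by
    refine ⟨N.mul_mem_right _ hn, ?_⟩
    change _ ≤ v (algebraMap R K (n * r))
    rw [hr', v.map_mul, ht]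
    exact le_add_coe_iff.mpr ((mem_valuationRing v _).mp (g z).2)
  exact ⟨⟨n * r, hmem⟩, (h.leadingForm_apply N ht _ (g z) hr').trans (hg z)⟩

end LeadingForms

/-! ### Length as a count of missing values. -/

section LengthCount

variable {R : Type*} [CommRing R] [IsLocalRing R] {K : Type*} [Field K] [Algebra R K]
variable {d : ℕ} {a : EuclideanSpace ℝ (Fin d)} {ha : LinearIndependent ℚ (fun i => a i)}
variable {v : AddValuation K (WithTop (Lattice a ha))}

omit [IsLocalRing R] in
theorem mem_ringValues {u : Lattice a ha} :
    u ∈ ringValues R v ↔ ∃ x : R, v (algebraMap R K x) = u := by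
  simp [ringValues, valueSet]

omit [IsLocalRing R] in
theorem idealValues_subset (N : Ideal R) : idealValues v N ⊆ ringValues R v := fun _ hu => by
  obtain ⟨x, -, hx⟩ := mem_idealValues.mp hu
  exact mem_ringValues.mpr ⟨x, hx⟩

omit [IsLocalRing R] in
theorem idealValues_top : idealValues v (⊤ : Ideal R) = ringValues R v := by
  ext u
  simp [mem_idealValues, mem_ringValues]

/-- The length of `R` modulo the elements of value at least `H` is estimated twice, through the
values of `R` and through those of `N`. In each case the upper and lower counts differ only in the
slab within `w` of `H`. -/
theorem Dominates.length_quotient_bounds (h : Dominates R v) (hfin : h.residueMap.Finite)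
    (hval : valueSet v Set.univ = Set.univ) {w : Lattice a ha} (hw0 : 0 ≤ w)
    (hw : ∀ (N : Ideal R) (u : Lattice a ha), u ∈ idealValues v N →
      ∃ (t : K) (ht : v t = (u + w : Lattice a ha)), LinearMap.range (h.leadingForm N ht) = ⊤)
    (N : Ideal R) (H : Lattice a ha) (hHN : h.valueIdeal H ≤ N)
    (hfinite : (ringValues R v ∩ Set.Iio H).Finite) :
    Module.length R (R ⧸ N) ≤ h.residueDegree * ((ringValues R v \ idealValues v N).ncard +
      (ringValues R v ∩ {u | H ≤ u + w ∧ u < H}).ncard : ℕ) ∧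
    (h.residueDegree * (ringValues R v \ idealValues v N).ncard : ℕ) ≤
      Module.length R (R ⧸ N) + (h.residueDegree *
        (ringValues R v ∩ {u | H ≤ u + w ∧ u < H}).ncard : ℕ) := by
  classical
  set S := ringValues R v with hS
  set T := idealValues v N with hT
  set D := h.residueDegree
  have hTS : T ⊆ S := idealValues_subset N
  have hE : S \ T ⊆ S ∩ Set.Iio H := by
    rintro u ⟨hu, hu'⟩
    refine ⟨hu, Set.mem_Iio.mpr (lt_of_not_ge fun hHu => hu' ?_)⟩
    obtain ⟨x, hx⟩ := mem_ringValues.mp hu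
    exact mem_idealValues.mpr ⟨x, hHN (h.mem_valueIdeal.mpr (hx ▸ WithTop.coe_le_coe.mpr hHu)), hx⟩
  have hlow : ∀ u, u + w < H → u < H := fun u hu => (le_add_of_nonneg_right hw0).trans_lt hu
  have hle : ∀ N' : Ideal R, Module.length R (R ⧸ (N' ⊓ h.valueIdeal H)) ≤
      Module.length R (R ⧸ N') + D * ((idealValues v N' ∩ Set.Iio H).ncard : ℕ) := by
    intro N'
    have hf : (idealValues v N' ∩ Set.Iio H).Finite :=
      hfinite.subset (Set.inter_subset_inter_left _ (idealValues_subset N'))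
    rw [Set.ncard_eq_toFinset_card _ hf]
    exact h.length_inf_valueIdeal_le hfin hval N' hf.toFinset H
      (fun u hu hu' => hf.mem_toFinset.mpr ⟨hu, hu'⟩) (fun u hu => (hf.mem_toFinset.mp hu).2)
  have hge : ∀ N' : Ideal R, Module.length R (R ⧸ N') +
      D * ((idealValues v N' ∩ {u | u + w < H}).ncard : ℕ) ≤
        Module.length R (R ⧸ (N' ⊓ h.valueIdeal H)) := by
    intro N'
    have hf : (idealValues v N' ∩ {u | u + w < H}).Finite :=
      hfinite.subset (Set.inter_subset_inter (idealValues_subset N') hlow)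
    -- The lower bound is applied at the shifted values `u + w`, where leading forms are surjective.
    have hcard : (hf.toFinset.image (· + w)).card =
        (idealValues v N' ∩ {u | u + w < H}).ncard := by
      rw [Finset.card_image_of_injective _ (add_left_injective w),
        Set.ncard_eq_toFinset_card _ hf]
    rw [← hcard]
    refine h.le_length_inf_valueIdeal hfin N' _ ?_ H ?_
    · intro u hu
      obtain ⟨u', hu', rfl⟩ := Finset.mem_image.mp hu
      exact hw N' u' (hf.mem_toFinset.mp hu').1
    · intro u hu
      obtain ⟨u', hu', rfl⟩ := Finset.mem_image.mp hu
      exact (hf.mem_toFinset.mp hu').2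
  have htop : Module.length R (R ⧸ (⊤ : Ideal R)) = 0 := Module.length_eq_zero
  have h1 := hle ⊤
  have h2 := hge ⊤
  have h3 := hle N
  have h4 := hge N
  rw [htop, zero_add, idealValues_top, top_inf_eq] at h1 h2
  rw [inf_eq_right.mpr hHN] at h3 h4
  set slab := S ∩ {u | H ≤ u + w ∧ u < H} with hslab
  have hslabfin : slab.Finite := hfinite.subset fun u hu => ⟨hu.1, hu.2.2⟩
  have hs : (S ∩ Set.Iio H).ncard ≤ (S ∩ {u | u + w < H}).ncard + slab.ncard := by
    refine (Set.ncard_le_ncard ?_ ?_).trans (Set.ncard_union_le _ _)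
    · rintro u ⟨hu, hu'⟩
      by_cases hc : u + w < H
      · exact Or.inl ⟨hu, hc⟩
      · exact Or.inr ⟨hu, not_lt.mp hc, hu'⟩
    · exact (hfinite.subset (Set.inter_subset_inter_right _ hlow)).union hslabfin
  have ht : (T ∩ Set.Iio H).ncard ≤ (T ∩ {u | u + w < H}).ncard + slab.ncard := by
    refine (Set.ncard_le_ncard ?_ ?_).trans (Set.ncard_union_le _ _)
    · rintro u ⟨hu, hu'⟩
      by_cases hc : u + w < H
      · exact Or.inl ⟨hu, hc⟩
      · exact Or.inr ⟨hTS hu, not_lt.mp hc, hu'⟩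
    · exact (hfinite.subset (Set.inter_subset_inter hTS hlow)).union hslabfin
  have hst : (S ∩ Set.Iio H).ncard = (S \ T).ncard + (T ∩ Set.Iio H).ncard := by
    rw [← Set.ncard_union_eq _ (hfinite.subset hE)
      (hfinite.subset (Set.inter_subset_inter_left _ hTS))]
    · congr 1
      ext u
      constructor
      · rintro ⟨hu, hu'⟩
        by_cases hc : u ∈ T
        · exact Or.inr ⟨hc, hu'⟩
        · exact Or.inl ⟨hu, hc⟩
      · rintro (hu | hu)
        · exact hE hu
        · exact ⟨hTS hu.1, hu.2⟩
    · exact Set.disjoint_left.mpr fun u hu hu' => hu.2 hu'.1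
  generalize (S ∩ Set.Iio H).ncard = s at *
  generalize (T ∩ Set.Iio H).ncard = t at *
  generalize (S ∩ {u | u + w < H}).ncard = s' at *
  generalize (T ∩ {u | u + w < H}).ncard = t' at *
  generalize slab.ncard = b at *
  generalize (S \ T).ncard = E at *
  generalize Module.length R (R ⧸ N) = l at *
  -- Both lengths are finite, so the inequalities become arithmetic in `ℕ`, where terms can be
  -- cancelled.
  obtain ⟨j, hj⟩ := ENat.ne_top_iff_exists.mp
    (ne_top_of_le_ne_top (by exact_mod_cast ENat.natCast_ne_top (D * s)) h1)
  rw [← hj] at h1 h2 h3 h4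
  obtain ⟨l, rfl⟩ := ENat.ne_top_iff_exists.mp
    (ne_top_of_le_ne_top (ENat.natCast_ne_top j) (le_self_add.trans h4))
  norm_cast at *
  have hs' := Nat.mul_le_mul_left D hs
  have ht' := Nat.mul_le_mul_left D ht
  subst hst
  simp only [mul_add] at *
  omega

end LengthCount

/-! ### Counting lattice points by volume. -/

section LatticePoints

variable {d : ℕ} {a : EuclideanSpace ℝ (Fin d)} {ha : LinearIndependent ℚ (fun i => a i)}

/-- The inclusion `ℤ^d → ℝ^d` as a homomorphism. -/
def Lattice.toRealHom : Lattice a ha →+ EuclideanSpace ℝ (Fin d) where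
  toFun := Lattice.toReal
  map_zero' := by
    ext i
    exact Int.cast_zero
  map_add' := Lattice.toReal_add

theorem Lattice.toReal_sub (u w : Lattice a ha) : (u - w).toReal = u.toReal - w.toReal :=
  map_sub Lattice.toRealHom u w

theorem Lattice.toReal_nsmul (n : ℕ) (u : Lattice a ha) : (n • u).toReal = (n : ℝ) • u.toReal := by
  rw [Nat.cast_smul_eq_nsmul]
  exact map_nsmul Lattice.toRealHom n u

theorem Lattice.toReal_sum {ι : Type*} (s : Finset ι) (f : ι → Lattice a ha) :
    (∑ i ∈ s, f i).toReal = ∑ i ∈ s, (f i).toReal := map_sum Lattice.toRealHom f s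

instance : Countable (Lattice a ha) := inferInstanceAs (Countable (Fin d → ℤ))

theorem Lattice.lt_iff (u w : Lattice a ha) :
    u < w ↔ (inner ℝ u.toReal a : ℝ) < inner ℝ w.toReal a := Iff.rfl

theorem finite_norm_toReal_le (M : ℝ) : {u : Lattice a ha | ‖u.toReal‖ ≤ M}.Finite := by
  have h : {u : Fin d → ℤ | ‖Lattice.toReal (a := a) (ha := ha) u‖ ≤ M}.Finite := by
    refine (Set.finite_Icc (fun _ => -⌈M⌉ : Fin d → ℤ) (fun _ => ⌈M⌉)).subset fun u hu => ?_
    have hi : ∀ i, |(u i : ℝ)| ≤ ⌈M⌉ := fun i =>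
      ((PiLp.norm_apply_le (Lattice.toReal (a := a) (ha := ha) u) i).trans hu).trans (Int.le_ceil M)
    constructor <;> intro i
    · exact_mod_cast neg_le_of_abs_le (hi i)
    · exact_mod_cast le_of_abs_le (hi i)
  exact h

theorem norm_latticeFloor_sub_le (n : ℕ) (x : EuclideanSpace ℝ (Fin d)) :
    ‖(latticeFloor a ha n x).toReal - (n : ℝ) • x‖ ≤ √d := by
  rw [EuclideanSpace.norm_eq]
  apply Real.sqrt_le_sqrt
  have : ∀ i ∈ Finset.univ, ‖((latticeFloor a ha n x).toReal - (n : ℝ) • x) i‖ ^ 2 ≤ (1 : ℝ) := by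
    intro i _
    have h1 : ((latticeFloor a ha n x).toReal - (n : ℝ) • x) i = -Int.fract ((n : ℝ) * x i) := by
      rw [Int.fract]
      change (⌊(n : ℝ) * x i⌋ : ℝ) - (n : ℝ) * x i = _
      ring
    rw [h1, norm_neg, Real.norm_of_nonneg (Int.fract_nonneg _)]
    exact pow_le_one₀ (Int.fract_nonneg _) (Int.fract_lt_one _).le
  simpa using Finset.sum_le_sum this

theorem measurableSet_latticeFloor (n : ℕ) (U : Set (Lattice a ha)) :
    MeasurableSet {x | latticeFloor a ha n x ∈ U} := by
  have hf : Measurable (fun (x : EuclideanSpace ℝ (Fin d)) (i : Fin d) => ⌊(n : ℝ) * x i⌋) := by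
    fun_prop
  have hU : MeasurableSet (show Set (Fin d → ℤ) from U) := MeasurableSet.of_discrete
  exact hf hU

theorem volume_latticeFloor_eq {n : ℕ} (hn : n ≠ 0) (u : Lattice a ha) :
    volume {x | latticeFloor a ha n x = u} = ((n : ENNReal) ^ d)⁻¹ := by
  have hn' : (0 : ℝ) < n := by positivity
  have hset : {x | latticeFloor a ha n x = u} = WithLp.ofLp ⁻¹'
      Set.pi Set.univ fun i => Set.Ico ((u.coord i : ℝ) / n) ((u.coord i + 1 : ℝ) / n) := by
    ext x
    have : latticeFloor a ha n x = u ↔ ∀ i, ⌊(n : ℝ) * x i⌋ = u.coord i := funext_iff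
    rw [Set.mem_ofPred_eq, this]
    simp only [Set.mem_preimage, Set.mem_univ_pi, Set.mem_Ico, Int.floor_eq_iff, div_le_iff₀' hn',
      lt_div_iff₀' hn']
  rw [hset, (PiLp.volume_preserving_ofLp (Fin d)).measure_preimage
    (MeasurableSet.univ_pi fun i => measurableSet_Ico).nullMeasurableSet, Real.volume_pi_Ico]
  have : ∀ i, ENNReal.ofReal ((u.coord i + 1 : ℝ) / n - (u.coord i : ℝ) / n) =
      (n : ENNReal)⁻¹ := by
    intro i
    rw [← sub_div, add_sub_cancel_left, one_div, ENNReal.ofReal_inv_of_pos hn',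
      ENNReal.ofReal_natCast]
  simp [this, ENNReal.inv_pow]

theorem volume_latticeFloor_mem {n : ℕ} (hn : n ≠ 0) {U : Set (Lattice a ha)} (hU : U.Finite) :
    volume {x | latticeFloor a ha n x ∈ U} = (U.ncard : ENNReal) / (n : ENNReal) ^ d := by
  have hset : {x | latticeFloor a ha n x ∈ U} =
      ⋃ u ∈ hU.toFinset, {x | latticeFloor a ha n x = u} := by
    ext x
    simp
  rw [hset, measure_biUnion_finset]
  · simp only [volume_latticeFloor_eq hn, Finset.sum_const, nsmul_eq_mul,
      Set.ncard_eq_toFinset_card U hU, div_eq_mul_inv]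
  · intro u _ w _ huw
    exact Set.disjoint_left.mpr fun x hx hx' => huw (hx.symm.trans hx')
  · intro u _
    exact measurableSet_latticeFloor n {u}

/-- The quotient is the volume of the union of the cells `u/q + [0, 1/q)^d`, `u ∈ U e`. The cells
all lie in the ball of radius `M + √d`, so almost everywhere convergence of indicators suffices. -/
theorem tendsto_ncard_div_pow {p : ℕ} (hp : p ≠ 0) {U : ℕ → Set (Lattice a ha)} {M : ℝ}
    (hU : ∀ e, ∀ u ∈ U e, ‖u.toReal‖ ≤ M * p ^ e) {A : Set (EuclideanSpace ℝ (Fin d))}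
    (hA : MeasurableSet A)
    (hlim : ∀ᵐ x, ∀ᶠ e in atTop, latticeFloor a ha (p ^ e) x ∈ U e ↔ x ∈ A) :
    Tendsto (fun e => ((U e).ncard : ENNReal) / ((p : ENNReal) ^ e) ^ d) atTop
      (𝓝 (volume A)) := by
  have h1 : ∀ e, ((U e).ncard : ENNReal) / ((p : ENNReal) ^ e) ^ d =
      volume {x | latticeFloor a ha (p ^ e) x ∈ U e} := by
    intro e
    rw [volume_latticeFloor_mem (pow_ne_zero e hp)
      ((finite_norm_toReal_le (M * p ^ e)).subset (hU e)), Nat.cast_pow]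
  simp only [h1]
  refine tendsto_measure_of_ae_tendsto_indicator atTop hA
    (fun e => measurableSet_latticeFloor _ _)
    (B := Metric.closedBall 0 (M + √d)) Metric.isClosed_closedBall.measurableSet
    measure_closedBall_lt_top.ne (Eventually.of_forall fun e x hx => ?_) hlim
  have hq : (1 : ℝ) ≤ (p : ℝ) ^ e :=
    one_le_pow₀ (by exact_mod_cast Nat.one_le_iff_ne_zero.mpr hp)
  have h2 := hU e _ hx
  have h3 := norm_latticeFloor_sub_le (a := a) (ha := ha) (p ^ e) x
  rw [mem_closedBall_zero_iff]
  have h4 : ‖((p ^ e : ℕ) : ℝ) • x‖ ≤ M * p ^ e + √d :=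
    (norm_le_norm_add_norm_sub _ _).trans (add_le_add h2 h3)
  rw [norm_smul, Nat.cast_pow, Real.norm_of_nonneg (by positivity)] at h4
  have h5 : √(d : ℝ) ≤ √d * (p : ℝ) ^ e := le_mul_of_one_le_right (Real.sqrt_nonneg _) hq
  nlinarith

end LatticePoints

/-! ### Lattice points of a semigroup inside its cone. -/

section Semigroup

variable {d : ℕ} {a : EuclideanSpace ℝ (Fin d)} {ha : LinearIndependent ℚ (fun i => a i)}

theorem span_toReal_eq_top {S : Set (Lattice a ha)} (hgen : AddSubgroup.closure S = ⊤) :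
    Submodule.span ℝ (Lattice.toReal '' S) = ⊤ := by
  have hmem : ∀ u : Lattice a ha, u.toReal ∈ Submodule.span ℝ (Lattice.toReal '' S) := by
    intro u
    have hu : u ∈ AddSubgroup.closure S := hgen ▸ AddSubgroup.mem_top u
    have hle : AddSubgroup.closure S ≤
        (Submodule.span ℝ (Lattice.toReal '' S)).toAddSubgroup.comap Lattice.toRealHom := by
      rw [AddSubgroup.closure_le]
      exact fun s hs => Submodule.subset_span (Set.mem_image_of_mem _ hs)
    exact hle hu
  rw [eq_top_iff]
  intro x _
  have hx : x = ∑ i, x i • Lattice.toReal (a := a) (ha := ha) (Pi.single i 1 : Fin d → ℤ) := by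
    ext j
    have : ∀ i, (Lattice.toReal (a := a) (ha := ha) (Pi.single i 1 : Fin d → ℤ)) j =
        if i = j then 1 else 0 := by
      intro i
      change ((Pi.single i 1 : Fin d → ℤ) j : ℝ) = _
      rcases eq_or_ne i j with rfl | hij
      · simp
      · simp [hij]
    simp [this]
  rw [hx]
  exact Submodule.sum_mem _ fun i _ => Submodule.smul_mem _ _ (hmem _)

theorem convex_closedCone (U : Set (EuclideanSpace ℝ (Fin d))) : Convex ℝ (closedCone U) :=
  (PointedCone.convex _).closure

theorem subset_closedCone (U : Set (EuclideanSpace ℝ (Fin d))) : U ⊆ closedCone U :=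
  fun _ hx => subset_closure (PointedCone.subset_hull hx)

theorem smul_mem_closedCone {U : Set (EuclideanSpace ℝ (Fin d))} {c : ℝ} (hc : 0 ≤ c)
    {x : EuclideanSpace ℝ (Fin d)} (hx : x ∈ closedCone U) : c • x ∈ closedCone U := by
  have h : Set.MapsTo (fun y : EuclideanSpace ℝ (Fin d) => c • y)
      (PointedCone.hull ℝ U : Set (EuclideanSpace ℝ (Fin d))) (PointedCone.hull ℝ U) :=
    fun y hy => Submodule.smul_mem (PointedCone.hull ℝ U) (⟨c, hc⟩ : {c : ℝ // 0 ≤ c}) hy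
  exact h.closure (continuous_const_smul c) hx

theorem interior_hull_nonempty {S : Set (Lattice a ha)} (hgen : AddSubgroup.closure S = ⊤) :
    (interior (PointedCone.hull ℝ (Lattice.toReal '' S) :
      Set (EuclideanSpace ℝ (Fin d)))).Nonempty := by
  rw [(PointedCone.convex _).interior_nonempty_iff_affineSpan_eq_top, eq_top_iff]
  have h1 : insert 0 (Lattice.toReal '' S) ⊆
      (PointedCone.hull ℝ (Lattice.toReal '' S) : Set (EuclideanSpace ℝ (Fin d))) :=
    Set.insert_subset (Submodule.zero_mem _) PointedCone.subset_hull
  refine le_trans ?_ (affineSpan_mono ℝ h1)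
  intro x _
  rw [← SetLike.mem_coe, affineSpan_insert_zero, span_toReal_eq_top hgen]
  trivial

/-- An interior point lies in the interior of a simplex inside the cone, and each vertex of it uses
finitely many generators. -/
theorem exists_finset_mem_interior_hull {E : Type*} [NormedAddCommGroup E] [NormedSpace ℝ E]
    [FiniteDimensional ℝ E] {U : Set E} {z : E}
    (hz : z ∈ interior (PointedCone.hull ℝ U : Set E)) :
    ∃ F : Finset E, (F : Set E) ⊆ U ∧ z ∈ interior (PointedCone.hull ℝ (F : Set E) : Set E) := by
  classical
  obtain ⟨b, hzb, hb⟩ := exists_mem_interior_convexHull_affineBasis (mem_interior_iff_mem_nhds.mp hz)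
  choose G hGU hG using fun i =>
    Submodule.mem_span_finite_of_mem_span (hb (subset_convexHull ℝ _ (Set.mem_range_self i)))
  refine ⟨Finset.univ.biUnion G, by simpa using hGU, ?_⟩
  refine interior_mono (convexHull_min ?_ (PointedCone.convex _)) hzb
  rintro _ ⟨i, rfl⟩
  refine Submodule.span_mono ?_ (hG i)
  exact_mod_cast Finset.subset_biUnion_of_mem G (Finset.mem_univ i)

/-- Every group element is a difference of two elements of `S`; adding up the subtrahends for `r ∈
B` gives a common shift. -/
theorem exists_add_mem {G : Type*} [AddCommGroup G] {S : Set G} (h0 : 0 ∈ S)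
    (hadd : ∀ u ∈ S, ∀ w ∈ S, u + w ∈ S) (hgen : AddSubgroup.closure S = ⊤) {B : Set G}
    (hB : B.Finite) : ∃ h ∈ S, ∀ r ∈ B, r + h ∈ S := by
  have hone : ∀ r : G, ∃ h ∈ S, r + h ∈ S := by
    intro r
    have hr : r ∈ AddSubgroup.closure S := hgen ▸ AddSubgroup.mem_top r
    induction hr using AddSubgroup.closure_induction with
    | mem x hx => exact ⟨0, h0, by simpa using hx⟩
    | zero => exact ⟨0, h0, by simpa using h0⟩
    | add x y _ _ hx hy =>
      obtain ⟨h1, hh1, hx⟩ := hx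
      obtain ⟨h2, hh2, hy⟩ := hy
      exact ⟨h1 + h2, hadd _ hh1 _ hh2, by rw [add_add_add_comm]; exact hadd _ hx _ hy⟩
    | neg x _ hx =>
      obtain ⟨h1, hh1, hx⟩ := hx
      exact ⟨x + h1, hx, by simpa using hh1⟩
  induction B, hB using Set.Finite.induction_on with
  | empty => exact ⟨0, h0, by simp⟩
  | insert _ _ ih =>
    rename_i r B _ _
    obtain ⟨h1, hh1, hB⟩ := ih
    obtain ⟨h2, hh2, hr⟩ := hone r
    refine ⟨h1 + h2, hadd _ hh1 _ hh2, ?_⟩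
    rintro s (rfl | hs)
    · rw [add_left_comm]
      exact hadd _ hh1 _ hr
    · rw [← add_assoc]
      exact hadd _ (hB s hs) _ hh2

/-- A lattice point of a cone spanned by a finite `F ⊆ S` is an `ℕ`-combination of `F` plus a
bounded remainder. There are finitely many remainders, and one `h ∈ S` moves them all into `S`; far
out along `z`, subtracting `h` first does not leave the cone. -/
theorem exists_mem_of_mem_interior {S : Set (Lattice a ha)} (h0 : 0 ∈ S)
    (hadd : ∀ u ∈ S, ∀ w ∈ S, u + w ∈ S) (hgen : AddSubgroup.closure S = ⊤)
    {z : EuclideanSpace ℝ (Fin d)} (hz : z ∈ interior (closedCone (Lattice.toReal '' S))) :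
    ∃ ε > 0, ∃ M : ℝ, ∀ t ≥ M, ∀ u : Lattice a ha, ‖u.toReal - t • z‖ ≤ ε * t → u ∈ S := by
  classical
  -- Taking the closure adds no interior points, so `z` is interior to the cone of finite
  -- combinations.
  rw [closedCone, (PointedCone.convex _).interior_closure_eq_interior_of_nonempty_interior
    (interior_hull_nonempty hgen)] at hz
  obtain ⟨F', hF', hz⟩ := exists_finset_mem_interior_hull hz
  obtain ⟨F, hFS, rfl⟩ := Finset.subset_set_image_iff.mp hF'
  obtain ⟨δ, hδ, hball⟩ := Metric.nhds_basis_closedBall.mem_iff.mp (mem_interior_iff_mem_nhds.mp hz)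
  obtain ⟨h, hh, hhB⟩ := exists_add_mem h0 hadd hgen
    (finite_norm_toReal_le (a := a) (ha := ha) (∑ s ∈ F, ‖s.toReal‖))
  -- Half of `δ` absorbs the deviation of `u` from `t • z`, the other half the shift by `h`.
  refine ⟨δ / 2, by positivity, max 1 (‖h.toReal‖ / (δ / 2)), fun t ht u hu => ?_⟩
  have ht1 : 1 ≤ t := (le_max_left _ _).trans ht
  have ht0 : 0 < t := by linarith
  have hht : ‖h.toReal‖ ≤ δ / 2 * t :=
    (div_le_iff₀' (by positivity)).mp ((le_max_right _ _).trans ht)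
  have hcone : (u - h).toReal ∈ PointedCone.hull ℝ (Lattice.toReal '' (F : Set (Lattice a ha))) := by
    have hmem : t⁻¹ • (u - h).toReal ∈ Metric.closedBall z δ := by
      rw [mem_closedBall_iff_norm]
      have h1 : t⁻¹ • (u - h).toReal - z = t⁻¹ • ((u.toReal - t • z) - h.toReal) := by
        rw [Lattice.toReal_sub, sub_right_comm, smul_sub _ _ (t • z), inv_smul_smul₀ ht0.ne']
      rw [h1, norm_smul, norm_inv, Real.norm_of_nonneg ht0.le, inv_mul_le_iff₀ ht0]
      linarith [norm_sub_le (u.toReal - t • z) h.toReal]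
    have h2 := hball hmem
    rw [Finset.coe_image] at h2
    have h3 := Submodule.smul_mem _ (⟨t, ht0.le⟩ : {c : ℝ // 0 ≤ c}) h2
    rwa [Nonneg.mk_smul, smul_inv_smul₀ ht0.ne'] at h3
  obtain ⟨c, hc⟩ := (Submodule.mem_span_image_finset_iff_exists_fun _).mp hcone
  have hsum : ∀ n : F → ℕ, ∑ i, n i • (i : Lattice a ha) ∈ S := by
    intro n
    let P : AddSubmonoid (Lattice a ha) := ⟨⟨S, fun hu hw => hadd _ hu _ hw⟩, h0⟩
    exact P.sum_mem fun i _ => P.nsmul_mem (hFS i.2) _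
  set n : F → ℕ := fun i => ⌊(c i : ℝ)⌋₊ with hn
  set r : Lattice a ha := u - h - ∑ i, n i • (i : Lattice a ha) with hr
  have hrB : ‖r.toReal‖ ≤ ∑ s ∈ F, ‖s.toReal‖ := by
    have h4 : r.toReal = ∑ i : F, ((c i : ℝ) - n i) • (i : Lattice a ha).toReal := by
      rw [hr, Lattice.toReal_sub, Lattice.toReal_sum, ← hc, ← Finset.sum_sub_distrib]
      refine Finset.sum_congr rfl fun i _ => ?_
      rw [Lattice.toReal_nsmul, sub_smul]
      rfl
    rw [h4, ← Finset.sum_coe_sort F (fun s => ‖s.toReal‖)]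
    refine norm_sum_le_of_le _ fun i _ => ?_
    rw [norm_smul]
    refine mul_le_of_le_one_left (norm_nonneg _) ?_
    rw [Real.norm_eq_abs, abs_le]
    constructor
    · linarith [Nat.floor_le (c i).2]
    · linarith [Nat.lt_floor_add_one (c i : ℝ)]
  have hu' : u = (∑ i, n i • (i : Lattice a ha)) + (r + h) := by
    rw [hr]
    abel
  rw [hu']
  exact hadd _ (hsum n) _ (hhB r hrB)

end Semigroup

/-! ### A translation criterion for null sets. -/

section NullSets

variable {E : Type*} [NormedAddCommGroup E] [NormedSpace ℝ E] [MeasurableSpace E] [BorelSpace E]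
  [FiniteDimensional ℝ E]

/-- The translates of `s` by `w/(n+1)` are pairwise disjoint, and the translation vectors are
bounded. -/
theorem measure_eq_zero_of_forall_add_smul_notMem (μ : Measure E) [μ.IsAddHaarMeasure] {s : Set E}
    (hs : MeasurableSet s) (w : E) (h : ∀ x ∈ s, ∀ t : ℝ, 0 < t → x + t • w ∉ s) : μ s = 0 := by
  have hb : Bornology.IsBounded (Set.range fun n : ℕ => ((n : ℝ) + 1)⁻¹ • w) := by
    refine (isBounded_iff_forall_norm_le).mpr ⟨‖w‖, ?_⟩
    rintro _ ⟨n, rfl⟩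
    rw [norm_smul, norm_inv, Real.norm_of_nonneg (by positivity)]
    exact mul_le_of_le_one_left (norm_nonneg _) (inv_le_one_of_one_le₀ (by simp))
  refine Measure.addHaar_eq_zero_of_disjoint_translates μ _ hb ?_ hs
  have key : ∀ m n : ℕ, m < n → ∀ x ∈ s, ∀ y ∈ s,
      ((m : ℝ) + 1)⁻¹ • w + x ≠ ((n : ℝ) + 1)⁻¹ • w + y := by
    intro m n hmn x hx y hy hxy
    have hlt : ((n : ℝ) + 1)⁻¹ < ((m : ℝ) + 1)⁻¹ := by gcongr
    refine h x hx (((m : ℝ) + 1)⁻¹ - ((n : ℝ) + 1)⁻¹) (sub_pos.mpr hlt) ?_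
    have : x + (((m : ℝ) + 1)⁻¹ - ((n : ℝ) + 1)⁻¹) • w = y := by
      rw [sub_smul, ← add_right_inj (((n : ℝ) + 1)⁻¹ • w), ← hxy]
      abel
    rwa [this]
  intro m n hmn
  rw [Function.onFun, Set.disjoint_left]
  rintro z hz hz'
  rw [Set.singleton_add] at hz hz'
  obtain ⟨x, hx, rfl⟩ := hz
  obtain ⟨y, hy, hxy⟩ := hz'
  rcases hmn.lt_or_gt with hlt | hlt
  · exact key m n hlt x hx y hy hxy.symm
  · exact key n m hlt y hy x hx hxy

end NullSets

/-! ### Asymptotics of value sets. -/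

section Limits

variable {d : ℕ} {a : EuclideanSpace ℝ (Fin d)} {ha : LinearIndependent ℚ (fun i => a i)}

theorem tendsto_inv_smul_latticeFloor (x : EuclideanSpace ℝ (Fin d)) :
    Tendsto (fun n : ℕ => (n : ℝ)⁻¹ • (latticeFloor a ha n x).toReal) atTop (𝓝 x) := by
  rw [tendsto_iff_norm_sub_tendsto_zero]
  refine squeeze_zero' (Eventually.of_forall fun _ => norm_nonneg _) ?_
    (tendsto_const_div_atTop_nhds_zero_nat (√(d : ℝ)))
  filter_upwards [eventually_gt_atTop 0] with n hn
  have hn' : (0 : ℝ) < n := by exact_mod_cast hn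
  have h1 : (n : ℝ)⁻¹ • (latticeFloor a ha n x).toReal - x =
      (n : ℝ)⁻¹ • ((latticeFloor a ha n x).toReal - (n : ℝ) • x) := by
    rw [smul_sub, inv_smul_smul₀ hn'.ne']
  rw [h1, norm_smul, norm_inv, Real.norm_of_nonneg hn'.le, inv_mul_eq_div]
  gcongr
  exact norm_latticeFloor_sub_le n x

theorem tendsto_inner_latticeFloor_add_div (x : EuclideanSpace ℝ (Fin d)) (b : ℝ) :
    Tendsto (fun n : ℕ => (inner ℝ (latticeFloor a ha n x).toReal a + b) / n) atTop
      (𝓝 (inner ℝ x a)) := by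
  have h1 := ((tendsto_inv_smul_latticeFloor (ha := ha) x).inner
    (tendsto_const_nhds (x := a)) (𝕜 := ℝ)).add (tendsto_const_div_atTop_nhds_zero_nat b)
  rw [add_zero] at h1
  refine h1.congr fun n => ?_
  rw [real_inner_smul_left, add_div, inv_mul_eq_div]

/-- For small `s > 0` the point `z - s • a` is still in `C`, so `⟨z, a⟩ ≥ s‖a‖² > 0`. -/
theorem IsPointedAt.inner_pos {C : Set (EuclideanSpace ℝ (Fin d))} (hC : IsPointedAt C a)
    {z : EuclideanSpace ℝ (Fin d)} (hz : z ∈ interior C) : 0 < inner ℝ z a := by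
  obtain ⟨c, hc0, hca, hc⟩ := hC
  have hlim : Tendsto (fun s : ℝ => z - s • a) (𝓝[>] 0) (𝓝 z) := by
    have : Tendsto (fun s : ℝ => z - s • a) (𝓝 0) (𝓝 (z - (0 : ℝ) • a)) :=
      Continuous.tendsto (by fun_prop) 0
    rw [zero_smul, sub_zero] at this
    exact this.mono_left nhdsWithin_le_nhds
  obtain ⟨s, hsC, hs⟩ := ((hlim.eventually_mem (mem_interior_iff_mem_nhds.mp hz)).and
    self_mem_nhdsWithin).exists
  have h1 := (mul_nonneg hc0.le (norm_nonneg _)).trans (hc _ hsC)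
  rw [inner_sub_left, real_inner_smul_left, real_inner_self_eq_norm_sq] at h1
  have h2 : 0 < s * ‖a‖ ^ 2 := mul_pos hs (pow_pos (hc0.trans hca) 2)
  linarith

variable {S : Set (Lattice a ha)}

theorem eventually_latticeFloor_mem (h0 : 0 ∈ S) (hadd : ∀ u ∈ S, ∀ w ∈ S, u + w ∈ S)
    (hgen : AddSubgroup.closure S = ⊤) {z : EuclideanSpace ℝ (Fin d)}
    (hz : z ∈ interior (closedCone (Lattice.toReal '' S))) :
    ∀ᶠ n : ℕ in atTop, latticeFloor a ha n z ∈ S := by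
  obtain ⟨ε, hε, M, h⟩ := exists_mem_of_mem_interior h0 hadd hgen hz
  filter_upwards [tendsto_natCast_atTop_atTop.eventually_ge_atTop M,
    tendsto_natCast_atTop_atTop.eventually_ge_atTop (√d / ε)] with n hn hn'
  exact h n hn _ ((norm_latticeFloor_sub_le n z).trans ((div_le_iff₀' hε).mp hn'))

theorem eventually_latticeFloor_notMem {z : EuclideanSpace ℝ (Fin d)}
    (hz : z ∉ closedCone (Lattice.toReal '' S)) :
    ∀ᶠ n : ℕ in atTop, latticeFloor a ha n z ∉ S := by
  have hopen : IsOpen (closedCone (Lattice.toReal '' S))ᶜ := isClosed_closure.isOpen_compl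
  filter_upwards [(tendsto_inv_smul_latticeFloor (ha := ha) z).eventually_mem
    (hopen.mem_nhds hz)] with n hn hmem
  exact hn (smul_mem_closedCone (by positivity)
    (subset_closedCone _ (Set.mem_image_of_mem _ hmem)))

variable {p : ℕ}

theorem tendsto_pow_atTop_nat (hp : 2 ≤ p) : Tendsto (fun e : ℕ => p ^ e) atTop atTop :=
  tendsto_pow_atTop_atTop_of_one_lt (by omega)

/-- After division by `q` the slab shrinks to the hyperplane `⟨x, a⟩ = β`, so every `x` off this
null set eventually leaves it; pointedness of the cone keeps it bounded. -/
theorem tendsto_ncard_slab_div_pow (hp : 2 ≤ p)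
    (hC : IsPointedAt (closedCone (Lattice.toReal '' S)) a) (c : ℕ) (w₀ w : Lattice a ha) :
    Tendsto (fun e => ((S ∩ {u | (c * p ^ e) • w₀ ≤ u + w ∧ u < (c * p ^ e) • w₀}).ncard :
      ENNReal) / ((p : ENNReal) ^ e) ^ d) atTop (𝓝 0) := by
  obtain ⟨c₀, hc₀, hca, hcone⟩ := hC
  set β : ℝ := c * inner ℝ w₀.toReal a with hβ
  have hH : ∀ e : ℕ, (inner ℝ ((c * p ^ e) • w₀).toReal a : ℝ) = β * p ^ e := by
    intro e
    rw [Lattice.toReal_nsmul, real_inner_smul_left, hβ]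
    push_cast
    ring
  have hnull : volume {x : EuclideanSpace ℝ (Fin d) | inner ℝ x a = β} = 0 := by
    refine measure_eq_zero_of_forall_add_smul_notMem volume
      (isClosed_eq (by fun_prop) continuous_const).measurableSet a fun x hx t ht hxt => ?_
    rw [Set.mem_ofPred_eq] at hx hxt
    rw [inner_add_left, real_inner_smul_left, hx, real_inner_self_eq_norm_sq] at hxt
    have : 0 < t * ‖a‖ ^ 2 := mul_pos ht (pow_pos (hc₀.trans hca) 2)
    linarith
  -- The limit `0` is read as the volume of the empty limit set.
  rw [← measure_empty (μ := (volume : Measure (EuclideanSpace ℝ (Fin d))))]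
  refine tendsto_ncard_div_pow (M := β / c₀) (by omega) ?_ MeasurableSet.empty ?_
  · rintro e u ⟨hu, -, hu'⟩
    rw [Lattice.lt_iff, hH] at hu'
    have := hcone _ (subset_closedCone _ (Set.mem_image_of_mem _ hu))
    rw [div_mul_eq_mul_div, le_div_iff₀' hc₀]
    linarith
  · rw [← compl_mem_ae_iff] at hnull
    filter_upwards [hnull] with x hx
    have hx' : (inner ℝ x a : ℝ) ≠ β := hx
    simp only [Set.mem_empty_iff_false, iff_false]
    have hpos : ∀ e : ℕ, (0 : ℝ) < ((p ^ e : ℕ) : ℝ) := fun e => by positivity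
    rcases hx'.lt_or_gt with hlt | hlt
    · filter_upwards [((tendsto_inner_latticeFloor_add_div (ha := ha) x
        (inner ℝ w.toReal a)).comp (tendsto_pow_atTop_nat hp)).eventually_lt_const hlt]
        with e he hmem
      have h1 := hmem.2.1
      rw [Lattice.le_iff, hH, Lattice.toReal_add, inner_add_left] at h1
      rw [Function.comp_apply, div_lt_iff₀ (hpos e), Nat.cast_pow] at he
      linarith
    · filter_upwards [((tendsto_inner_latticeFloor_add_div (ha := ha) x 0).comp
        (tendsto_pow_atTop_nat hp)).eventually_const_lt hlt] with e he hmem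
      have h1 := hmem.2.2
      rw [Lattice.lt_iff, hH] at h1
      rw [Function.comp_apply, lt_div_iff₀ (hpos e), Nat.cast_pow] at he
      linarith

variable {T : ℕ → Set (Lattice a ha)} {N : ℝ}

theorem eventually_latticeFloor_mem_of_inner_gt (hp : 2 ≤ p) (h0 : 0 ∈ S)
    (hadd : ∀ u ∈ S, ∀ w ∈ S, u + w ∈ S) (hgen : AddSubgroup.closure S = ⊤)
    (hN : ∀ e, ∀ u ∈ S, N * p ^ e ≤ inner ℝ u.toReal a → u ∈ T e)
    {x : EuclideanSpace ℝ (Fin d)} (hx : x ∈ interior (closedCone (Lattice.toReal '' S)))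
    (hxN : N < inner ℝ x a) : ∀ᶠ e in atTop, latticeFloor a ha (p ^ e) x ∈ T e := by
  filter_upwards [(tendsto_pow_atTop_nat hp).eventually (eventually_latticeFloor_mem h0 hadd hgen hx),
    ((tendsto_inner_latticeFloor_add_div (ha := ha) x 0).comp
      (tendsto_pow_atTop_nat hp)).eventually_const_lt hxN] with e he he'
  refine hN e _ he ?_
  rw [Function.comp_apply, lt_div_iff₀ (by positivity), Nat.cast_pow] at he'
  linarith

/-- One large `q₁` with `u = ⌊q₁x⌋ ∈ T e₁` is enough. For `q = q₁q₂` write `⌊q(x + z)⌋ = q₂u + g`;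
then `g` differs from `qz` by at most `2√d·q₂`, a small fraction of `q`. Hence `g ∈ S`, and `g` is
high enough to lie in `T e₂`, so `hT` applies. -/
theorem eventually_latticeFloor_mem_of_frequently (hp : 2 ≤ p) (h0 : 0 ∈ S)
    (hadd : ∀ u ∈ S, ∀ w ∈ S, u + w ∈ S) (hgen : AddSubgroup.closure S = ⊤)
    (hC : IsPointedAt (closedCone (Lattice.toReal '' S)) a)
    (hN : ∀ e, ∀ u ∈ S, N * p ^ e ≤ inner ℝ u.toReal a → u ∈ T e)
    (hT : ∀ e₁ e₂, ∀ u ∈ T e₁, ∀ w ∈ T e₂, p ^ e₂ • u + w ∈ T (e₁ + e₂))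
    {x z : EuclideanSpace ℝ (Fin d)} (hx : ∃ᶠ e in atTop, latticeFloor a ha (p ^ e) x ∈ T e)
    (hz : z ∈ interior (closedCone (Lattice.toReal '' S))) :
    ∀ᶠ e in atTop, latticeFloor a ha (p ^ e) (x + z) ∈ T e := by
  have hza := hC.inner_pos hz
  obtain ⟨ε, hε, M, h⟩ := exists_mem_of_mem_interior h0 hadd hgen hz
  set B : ℝ := √d with hB
  have hB0 : 0 ≤ B := Real.sqrt_nonneg _
  have hcast : Tendsto (fun e : ℕ => ((p ^ e : ℕ) : ℝ)) atTop atTop :=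
    tendsto_natCast_atTop_atTop.comp (tendsto_pow_atTop_nat hp)
  -- The last two thresholds on `q₁` turn the error `2Bq₂` into at most `ε q₁q₂` and ensure `⟨g, a⟩
  -- ≥ N q₂`.
  obtain ⟨e₁, hu, hM0, hM, hε', hN'⟩ := (hx.and_eventually
    ((hcast.eventually_ge_atTop 0).and ((hcast.eventually_ge_atTop M).and
      ((hcast.eventually_ge_atTop (2 * B / ε)).and
      (hcast.eventually_ge_atTop ((N + 2 * B * ‖a‖) / inner ℝ z a)))))).exists
  set u := latticeFloor a ha (p ^ e₁) x with hu_def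
  rw [div_le_iff₀' hε] at hε'
  rw [div_le_iff₀ hza] at hN'
  filter_upwards [eventually_ge_atTop e₁] with e he
  obtain ⟨e₂, rfl⟩ := Nat.exists_eq_add_of_le he
  set U := latticeFloor a ha (p ^ (e₁ + e₂)) (x + z) with hU_def
  have hq₂ : (1 : ℝ) ≤ ((p ^ e₂ : ℕ) : ℝ) := by
    exact_mod_cast Nat.one_le_pow _ _ (by omega)
  set q₁ : ℝ := ((p ^ e₁ : ℕ) : ℝ) with hq₁_def
  set q₂ : ℝ := ((p ^ e₂ : ℕ) : ℝ) with hq₂_def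
  have hq : ((p ^ (e₁ + e₂) : ℕ) : ℝ) = q₁ * q₂ := by
    rw [pow_add, Nat.cast_mul]
  set g := U - p ^ e₂ • u with hg
  have herr : ‖g.toReal - (q₁ * q₂) • z‖ ≤ 2 * B * q₂ := by
    have h1 : g.toReal - (q₁ * q₂) • z =
        (U.toReal - (q₁ * q₂) • (x + z)) - q₂ • (u.toReal - q₁ • x) := by
      rw [hg, Lattice.toReal_sub, Lattice.toReal_nsmul, ← hq₂_def]
      module
    have h2 : ‖U.toReal - (q₁ * q₂) • (x + z)‖ ≤ B := by
      rw [← hq]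
      exact norm_latticeFloor_sub_le _ _
    have h3 : ‖q₂ • (u.toReal - q₁ • x)‖ ≤ q₂ * B := by
      rw [norm_smul, Real.norm_of_nonneg (by linarith)]
      gcongr
      exact norm_latticeFloor_sub_le _ _
    rw [h1]
    refine (norm_sub_le _ _).trans ?_
    nlinarith
  have hgS : g ∈ S := by
    refine h (q₁ * q₂) (by nlinarith) g (herr.trans ?_)
    nlinarith
  have hgT : g ∈ T e₂ := by
    refine hN e₂ g hgS ?_
    have h1 : |(inner ℝ (g.toReal - (q₁ * q₂) • z) a : ℝ)| ≤ 2 * B * q₂ * ‖a‖ :=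
      (abs_real_inner_le_norm _ _).trans (by gcongr)
    rw [inner_sub_left, real_inner_smul_left] at h1
    have h2 := (abs_le.mp h1).1
    rw [← Nat.cast_pow, ← hq₂_def]
    nlinarith
  have hUg : U = p ^ e₂ • u + g := by
    rw [hg]
    abel
  rw [hUg]
  exact hT e₁ e₂ u hu g hgT

/-- The points of `C` whose lattice approximations lie in `T e` for all large `e`. -/
def limitOf (p : ℕ) (C : Set (EuclideanSpace ℝ (Fin d))) (T : ℕ → Set (Lattice a ha)) :
    Set (EuclideanSpace ℝ (Fin d)) :=
  ⋃ f : ℕ, ⋂ e ≥ f, {x | x ∈ C ∧ latticeFloor a ha (p ^ e) x ∈ T e}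

theorem mem_limitOf {C : Set (EuclideanSpace ℝ (Fin d))} {x : EuclideanSpace ℝ (Fin d)} :
    x ∈ limitOf p C T ↔ x ∈ C ∧ ∀ᶠ e in atTop, latticeFloor a ha (p ^ e) x ∈ T e := by
  simp only [limitOf, Set.mem_iUnion, Set.mem_iInter, Set.mem_ofPred_eq, eventually_atTop]
  constructor
  · rintro ⟨f, hf⟩
    exact ⟨(hf f le_rfl).1, f, fun e he => (hf e he).2⟩
  · rintro ⟨hx, f, hf⟩
    exact ⟨f, fun e he => ⟨hx, hf e he⟩⟩

theorem measurableSet_limitOf {C : Set (EuclideanSpace ℝ (Fin d))} (hC : MeasurableSet C) :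
    MeasurableSet (limitOf p C T) :=
  MeasurableSet.iUnion fun _ => MeasurableSet.iInter fun e => MeasurableSet.iInter fun _ =>
    hC.inter (measurableSet_latticeFloor (p ^ e) (T e))

open scoped Pointwise in
-- Moving an undecided point by any positive multiple of an interior vector `w` makes membership
-- eventual, so the translation criterion applies.
theorem volume_frequently_not_eventually (hp : 2 ≤ p) (h0 : 0 ∈ S)
    (hadd : ∀ u ∈ S, ∀ w ∈ S, u + w ∈ S) (hgen : AddSubgroup.closure S = ⊤)
    (hC : IsPointedAt (closedCone (Lattice.toReal '' S)) a)
    (hN : ∀ e, ∀ u ∈ S, N * p ^ e ≤ inner ℝ u.toReal a → u ∈ T e)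
    (hT : ∀ e₁ e₂, ∀ u ∈ T e₁, ∀ w ∈ T e₂, p ^ e₂ • u + w ∈ T (e₁ + e₂)) :
    volume {x | (∃ᶠ e in atTop, latticeFloor a ha (p ^ e) x ∈ T e) ∧
      ¬ ∀ᶠ e in atTop, latticeFloor a ha (p ^ e) x ∈ T e} = 0 := by
  obtain ⟨w, hw⟩ := interior_hull_nonempty hgen
  have hset : {x | (∃ᶠ e in atTop, latticeFloor a ha (p ^ e) x ∈ T e) ∧
      ¬ ∀ᶠ e in atTop, latticeFloor a ha (p ^ e) x ∈ T e} =
        (limitOf p Set.univ fun e => (T e)ᶜ)ᶜ ∩ (limitOf p Set.univ T)ᶜ := by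
    ext x
    simp [mem_limitOf, Filter.Frequently]
  have hmeas : MeasurableSet {x | (∃ᶠ e in atTop, latticeFloor a ha (p ^ e) x ∈ T e) ∧
      ¬ ∀ᶠ e in atTop, latticeFloor a ha (p ^ e) x ∈ T e} :=
    hset ▸ (measurableSet_limitOf .univ).compl.inter (measurableSet_limitOf .univ).compl
  refine measure_eq_zero_of_forall_add_smul_notMem volume hmeas w fun x hx t ht hxt => hxt.2 ?_
  refine eventually_latticeFloor_mem_of_frequently hp h0 hadd hgen hC hN hT hx.1 ?_
  have hw' : w ∈ interior (closedCone (Lattice.toReal '' S)) := interior_mono subset_closure hw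
  have hsub : t • interior (closedCone (Lattice.toReal '' S)) ⊆
      interior (closedCone (Lattice.toReal '' S)) := by
    refine interior_maximal ?_ (isOpen_interior.smul₀ ht.ne')
    rintro _ ⟨y, hy, rfl⟩
    exact smul_mem_closedCone ht.le (interior_subset hy)
  exact hsub (Set.smul_mem_smul_set hw')

/-- Outside two null sets, the frontier of the convex set `C` and the undecided points, membership
of `⌊qx⌋` in `S \ T e` stabilises. Values of height at least `N q` lie in `T e`, so by pointedness
everything happens within radius `N / c₀` after rescaling, up to the frontier. -/
theorem tendsto_ncard_sdiff_div_pow (hp : 2 ≤ p) (h0 : 0 ∈ S)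
    (hadd : ∀ u ∈ S, ∀ w ∈ S, u + w ∈ S) (hgen : AddSubgroup.closure S = ⊤)
    (hC : IsPointedAt (closedCone (Lattice.toReal '' S)) a)
    (hN : ∀ e, ∀ u ∈ S, N * p ^ e ≤ inner ℝ u.toReal a → u ∈ T e)
    (hT : ∀ e₁ e₂, ∀ u ∈ T e₁, ∀ w ∈ T e₂, p ^ e₂ • u + w ∈ T (e₁ + e₂)) :
    MeasurableSet (closedCone (Lattice.toReal '' S) \
      limitOf p (closedCone (Lattice.toReal '' S)) T) ∧
    volume (closedCone (Lattice.toReal '' S) \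
      limitOf p (closedCone (Lattice.toReal '' S)) T) < ⊤ ∧
    Tendsto (fun e => ((S \ T e).ncard : ENNReal) / ((p : ENNReal) ^ e) ^ d) atTop
      (𝓝 (volume (closedCone (Lattice.toReal '' S) \
        limitOf p (closedCone (Lattice.toReal '' S)) T))) := by
  have hnull := volume_frequently_not_eventually hp h0 hadd hgen hC hN hT
  set C := closedCone (Lattice.toReal '' S) with hC_def
  have hclosed : IsClosed C := isClosed_closure
  have hmeas : MeasurableSet (C \ limitOf p C T) :=
    hclosed.measurableSet.diff (measurableSet_limitOf hclosed.measurableSet)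
  have hfr : volume (frontier C) = 0 := (convex_closedCone _).addHaar_frontier volume
  obtain ⟨c₀, hc₀, -, hcone⟩ := id hC
  refine ⟨hmeas, ?_, ?_⟩
  · have hsub : C \ limitOf p C T ⊆ frontier C ∪ Metric.closedBall 0 (N / c₀) := by
      rintro x ⟨hxC, hx⟩
      by_cases hxi : x ∈ interior C
      · refine Or.inr ?_
        rw [mem_closedBall_zero_iff, le_div_iff₀' hc₀]
        refine (hcone x hxC).trans (not_lt.mp fun hlt => hx ?_)
        exact mem_limitOf.mpr
          ⟨hxC, eventually_latticeFloor_mem_of_inner_gt hp h0 hadd hgen hN hxi hlt⟩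
      · exact Or.inl ⟨subset_closure hxC, hxi⟩
    refine (measure_mono hsub).trans_lt ((measure_union_le _ _).trans_lt ?_)
    rw [hfr, zero_add]
    exact measure_closedBall_lt_top
  · refine tendsto_ncard_div_pow (M := N / c₀) (by omega) ?_ hmeas ?_
    · rintro e u ⟨hu, hu'⟩
      rw [div_mul_eq_mul_div, le_div_iff₀' hc₀]
      exact (hcone _ (subset_closedCone _ (Set.mem_image_of_mem _ hu))).trans
        (not_le.mp fun hle => hu' (hN e u hu hle)).le
    · rw [← compl_mem_ae_iff] at hnull hfr
      filter_upwards [hnull, hfr] with x hx hxf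
      by_cases hxC : x ∈ C
      · have hxi : x ∈ interior C := by
          by_contra hxi
          exact hxf ⟨subset_closure hxC, hxi⟩
        by_cases hev : ∀ᶠ e in atTop, latticeFloor a ha (p ^ e) x ∈ T e
        · filter_upwards [hev] with e he
          exact iff_of_false (fun h => h.2 he) fun h => h.2 (mem_limitOf.mpr ⟨hxC, hev⟩)
        · have hnot : ∀ᶠ e in atTop, latticeFloor a ha (p ^ e) x ∉ T e :=
            not_frequently.mp fun hfreq => hx ⟨hfreq, hev⟩
          filter_upwards [hnot, (tendsto_pow_atTop_nat hp).eventually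
            (eventually_latticeFloor_mem h0 hadd hgen hxi)] with e he he'
          exact iff_of_true ⟨he', he⟩ ⟨hxC, fun h => hev (mem_limitOf.mp h).2⟩
      · filter_upwards [(tendsto_pow_atTop_nat hp).eventually
          (eventually_latticeFloor_notMem (S := S) hxC)] with e he
        exact iff_of_false (fun h => he h.1) fun h => hxC h.1

end Limits

/-! ### Value sets of the ring and of the ideals. -/

section Values

variable {R : Type*} [CommRing R] {K : Type*} [Field K] [Algebra R K]
variable {d : ℕ} {a : EuclideanSpace ℝ (Fin d)} {ha : LinearIndependent ℚ (fun i => a i)}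
variable {v : AddValuation K (WithTop (Lattice a ha))}

theorem zero_mem_ringValues : (0 : Lattice a ha) ∈ ringValues R v :=
  mem_ringValues.mpr ⟨1, by simp⟩

theorem add_mem_ringValues : ∀ u ∈ ringValues R v, ∀ w ∈ ringValues R v,
    u + w ∈ ringValues R v := by
  intro u hu w hw
  obtain ⟨x, hx⟩ := mem_ringValues.mp hu
  obtain ⟨y, hy⟩ := mem_ringValues.mp hw
  exact mem_ringValues.mpr ⟨x * y, by rw [map_mul, v.map_mul, hx, hy, WithTop.coe_add]⟩

/-- The witness is `x^{q₂} y`. -/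
theorem IsFGraded.nsmul_add_mem_idealValues {p : ℕ} {I : ℕ → Ideal R} (hI : IsFGraded p I)
    (e₁ e₂ : ℕ) (u : Lattice a ha) (hu : u ∈ idealValues v (I e₁)) (w : Lattice a ha)
    (hw : w ∈ idealValues v (I e₂)) : p ^ e₂ • u + w ∈ idealValues v (I (e₁ + e₂)) := by
  obtain ⟨x, hx, hxu⟩ := mem_idealValues.mp hu
  obtain ⟨y, hy, hyw⟩ := mem_idealValues.mp hw
  refine mem_idealValues.mpr ⟨x ^ p ^ e₂ * y, hI e₁ e₂ (Ideal.mul_mem_mul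
    (Ideal.subset_span (Set.mem_image_of_mem _ hx)) hy), ?_⟩
  rw [map_mul, map_pow, v.map_mul, v.map_pow, hxu, hyw, WithTop.coe_add, WithTop.coe_nsmul]

theorem finite_ringValues_inter_Iio (hC : IsPointedAt (valueCone R v) a) (H : Lattice a ha) :
    (ringValues R v ∩ Set.Iio H).Finite := by
  obtain ⟨c, hc0, -, hc⟩ := hC
  refine (finite_norm_toReal_le (inner ℝ H.toReal a / c)).subset ?_
  rintro u ⟨hu, hu'⟩
  rw [Set.mem_ofPred_eq, le_div_iff₀' hc0]
  exact (hc _ (subset_closedCone _ (Set.mem_image_of_mem _ hu))).trans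
    ((Lattice.lt_iff _ _).mp hu').le

end Values

/-! ### Squeeze argument and conclusion. -/

theorem tendsto_of_le_mul_add {α : Type*} {l : Filter α} {f g s : α → ENNReal} {D V : ENNReal}
    (hD : D ≠ ⊤) (hg : Tendsto g l (𝓝 V)) (hs : Tendsto s l (𝓝 0))
    (hle : ∀ x, f x ≤ D * (g x + s x)) (hge : ∀ x, D * g x ≤ f x + D * s x) :
    Tendsto f l (𝓝 (D * V)) := by
  have hDs : Tendsto (fun x => D * s x) l (𝓝 0) := by
    simpa using ENNReal.Tendsto.const_mul hs (Or.inr hD)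
  have hDg : Tendsto (fun x => D * g x) l (𝓝 (D * V)) := ENNReal.Tendsto.const_mul hg (Or.inr hD)
  have hup : Tendsto (fun x => D * (g x + s x)) l (𝓝 (D * V)) := by
    simpa [mul_add] using hDg.add hDs
  have hlow : Tendsto (fun x => D * g x - D * s x) l (𝓝 (D * V)) := by
    simpa using ENNReal.Tendsto.sub hDg hDs (Or.inr ENNReal.zero_ne_top)
  exact tendsto_of_tendsto_of_tendsto_of_le_of_le hlow hup
    (fun x => tsub_le_iff_right.mpr (hge x)) hle

end OKDomain

end

theorem mainTheorem5 (p : ℕ) [Fact p.Prime]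
    (R : Type*) [CommRing R] [IsDomain R] [IsNoetherianRing R] [IsLocalRing R] [CharP R p]
    (hF : OKDomain.IsFFinite p R)
    (K : Type*) [Field K] [Algebra R K] [IsFractionRing R K]
    (d : ℕ) (a : EuclideanSpace ℝ (Fin d)) (ha : LinearIndependent ℚ (fun i => a i))
    (v : AddValuation K (WithTop (OKDomain.Lattice a ha)))
    (hv : OKDomain.IsOKValuation R v)
    (I : ℕ → Ideal R) (hI : OKDomain.IsFGraded p I) (hBBL : OKDomain.IsBBL p I) :
    MeasurableSet (OKDomain.valueCone R v \ OKDomain.limitSet p v I) ∧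
    volume (OKDomain.valueCone R v \ OKDomain.limitSet p v I) < ⊤ ∧
    Tendsto
      (fun e : ℕ => ((Module.length R (R ⧸ I e) : ℕ∞) : ENNReal) / ((p : ENNReal) ^ e) ^ d)
      atTop
      (𝓝 ((hv.dominates.residueDegree : ENNReal) *
        volume (OKDomain.valueCone R v \ OKDomain.limitSet p v I))) := by
  have hp : 2 ≤ p := (Fact.out : p.Prime).two_le
  obtain ⟨c, hc⟩ := hBBL
  obtain ⟨w₀, hw₀⟩ := hv.linear_bound
  obtain ⟨w, hw0, hw⟩ :=
    hv.dominates.exists_range_leadingForm_eq_top hv.finite_residue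
  -- The height is `H = cq • w₀`: the linear bound at `n = cq` puts elements of value at least `H`
  -- in `𝔪^{cq} ⊆ I_q`.
  have hle : ∀ e, hv.dominates.valueIdeal ((c * p ^ e) • w₀) ≤ I e := fun e r hr =>
    hc e (hw₀ _ r (hv.dominates.mem_valueIdeal.mp hr))
  have hN : ∀ e, ∀ u ∈ OKDomain.ringValues R v,
      (c * inner ℝ w₀.toReal a : ℝ) * p ^ e ≤ inner ℝ u.toReal a →
        u ∈ OKDomain.idealValues v (I e) := by
    intro e u hu hu'
    obtain ⟨x, hx⟩ := OKDomain.mem_ringValues.mp hu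
    refine OKDomain.mem_idealValues.mpr ⟨x, hle e (hv.dominates.mem_valueIdeal.mpr ?_), hx⟩
    rw [hx, WithTop.coe_le_coe, OKDomain.Lattice.le_iff, OKDomain.Lattice.toReal_nsmul,
      real_inner_smul_left]
    push_cast
    linarith
  -- `valueCone` and `limitSet` unfold to `closedCone` and `limitOf` for `S = ν(R)` and `T e = ν(I
  -- e)`.
  obtain ⟨hmeas, hfin, hlim⟩ := OKDomain.tendsto_ncard_sdiff_div_pow
    (T := fun e => OKDomain.idealValues v (I e)) hp OKDomain.zero_mem_ringValues
    OKDomain.add_mem_ringValues hv.closure_ringValues hv.pointed hN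
    hI.nsmul_add_mem_idealValues
  refine ⟨hmeas, hfin, OKDomain.tendsto_of_le_mul_add (ENNReal.natCast_ne_top _) hlim
    (OKDomain.tendsto_ncard_slab_div_pow (S := OKDomain.ringValues R v) hp hv.pointed c w₀ w)
    (fun e => ?_) (fun e => ?_)⟩
  · have h := ENat.toENNReal_le.mpr (hv.dominates.length_quotient_bounds hv.finite_residue
      hv.valueGroup_eq hw0 hw (I e) _ (hle e)
      (OKDomain.finite_ringValues_inter_Iio hv.pointed _)).1
    rw [← ENNReal.add_div, ← mul_div_assoc]
    refine ENNReal.div_le_div_right (h.trans_eq ?_) _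
    push_cast
    rfl
  · have h := ENat.toENNReal_le.mpr (hv.dominates.length_quotient_bounds hv.finite_residue
      hv.valueGroup_eq hw0 hw (I e) _ (hle e)
      (OKDomain.finite_ringValues_inter_Iio hv.pointed _)).2
    rw [← mul_div_assoc, ← mul_div_assoc, ← ENNReal.add_div]
    refine ENNReal.div_le_div_right (le_trans (le_of_eq ?_) (h.trans_eq ?_)) _
    · push_cast
      rfl
    · push_cast
      rfl
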